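/- Let $u:[0,\infty)\times(-\infty,0]\to\mathbb{C}$ be a continuous function which solves the Klein-Gordon equation $\partial_x\partial_y u+u=0$ in the sense of distributions in the open quarter-plane $(0,\infty)\times(-\infty,0)$. Suppose that $u(0,y)=0$ for all $y\le 0$. Let $\theta_1,\theta_2>0$ be real numbers and let $\mathcal{Y}\subset(-\infty,0]$ be a set with $0\in\mathcal{Y}$ and $\inf\mathcal{Y}=-\infty$, and suppose that there is a constant $C$ such that $$|u(x,y)|\le C\exp\big(\theta_1x+\theta_2|y|\big)\qquad\text{for all }x\ge 0\text{ and }y\in\mathcal{Y}.$$ If $\theta_1\theta_2<1$, then $u(x,y)=0$ for all $x\ge0$ and $y\le 0$. -/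

import Mathlib

open Set Filter Asymptotics

namespace KleinGordon

open MeasureTheory TopologicalSpace
open scoped Distributions LineDeriv

/-- The complex-valued distribution `φ ↦ ∫ φ u` on the open set `Ω ⊆ ℝ²` defined by a function `u`
that is locally integrable on `Ω` for Lebesgue measure (the zero distribution for other `u`). -/
noncomputable def toDistribution (Ω : Opens (ℝ × ℝ)) (u : ℝ × ℝ → ℂ) : 𝓓'(Ω, ℂ) :=
  (TestFunction.integralAgainstBilinCLM (ContinuousLinearMap.lsmul ℝ ℝ) volume u :
    𝓓(Ω, ℝ) →L[ℝ] ℂ)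

theorem toDistribution_apply {Ω : Opens (ℝ × ℝ)} {u : ℝ × ℝ → ℂ}
    (hu : LocallyIntegrableOn u Ω) (φ : 𝓓(Ω, ℝ)) :
    toDistribution Ω u φ = ∫ p, φ p • u p :=
  TestFunction.integralAgainstBilinCLM_eq_integral hu

/-- `u` is locally integrable on `Ω` and solves the Klein-Gordon equation `∂ₓ∂ᵧu + u = 0`
in the sense of distributions on `Ω`. -/
def IsDistributionalSolution (Ω : Opens (ℝ × ℝ)) (u : ℝ × ℝ → ℂ) : Prop :=
  LocallyIntegrableOn u Ω ∧
    ∂_{((1, 0) : ℝ × ℝ)} (∂_{((0, 1) : ℝ × ℝ)} (toDistribution Ω u)) + toDistribution Ω u = 0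

/-- The closed spacelike quarter-plane `{(x, y) | 0 ≤ x, y ≤ 0}`. -/
def closedQuarterPlane : Set (ℝ × ℝ) := Ici 0 ×ˢ Iic 0

/-- The open spacelike quarter-plane `{(x, y) | 0 < x, y < 0}`. -/
def openQuarterPlane : Opens (ℝ × ℝ) := ⟨Ioi 0 ×ˢ Iio 0, isOpen_Ioi.prod isOpen_Iio⟩

end KleinGordon

namespace KleinGordon

open MeasureTheory Topology Real
open scoped ContDiff Interval FourierTransform Distributions LineDeriv

/-! With `t = -y` the equation becomes `∂ₓ∂ₜw = w`. Since `w` vanishes at `x = 0`, it is the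
Volterra equation `w(x,t) = w(x,0) + ∫₀ᵗ∫₀ˣ w`; testing against products of one-variable bumps
extracts this from the distributional equation (`rectangle_eq`, `reflectedExtension_eq`).

Growth of order `θ₁` at `t = 0` propagates to all `t` (`norm_le_of_volterra`), so for `s > θ₁` the
Laplace transform in `x` exists. It satisfies `∂ₜL = L/s`, hence `L(s,t) = exp(t/s) L(s,0)`
(`integral_exp_smul_eq_of_volterra`). Along the times `-t ∈ Y` the hypothesis allows only growth
`exp(θ₂t)`, so `L(s,0) = 0` whenever `θ₁ < s < 1/θ₂`, an interval that is nonempty because `θ₁θ₂ <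
1`. By analyticity and Fourier inversion the data `w(·,0)` vanish (`eq_zero_of_laplace_eq_zero`),
and the propagation bound with constant zero then gives `w = 0`. -/

/-! ### Weak derivatives on the line -/

theorem smoothTransition_deriv_eq_zero {s : ℝ} (hs : s ∉ Icc (0 : ℝ) 1) :
    deriv smoothTransition s = 0 := by
  rw [mem_Icc, not_and_or, not_le, not_le] at hs
  rcases hs with hs | hs
  · have : smoothTransition =ᶠ[𝓝 s] fun _ ↦ 0 := by
      filter_upwards [Iio_mem_nhds hs] with t ht using smoothTransition.zero_of_nonpos (le_of_lt ht)
    rw [this.deriv_eq, deriv_const]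
  · have : smoothTransition =ᶠ[𝓝 s] fun _ ↦ 1 := by
      filter_upwards [Ioi_mem_nhds hs] with t ht using smoothTransition.one_of_one_le (le_of_lt ht)
    rw [this.deriv_eq, deriv_const]

theorem continuous_deriv_smoothTransition : Continuous (deriv smoothTransition) :=
  (smoothTransition.contDiff (n := 1)).continuous_deriv le_rfl

theorem hasDerivAt_smoothTransition_scaled (c ε x : ℝ) :
    HasDerivAt (fun x ↦ smoothTransition ((x - c) / ε))
      (ε⁻¹ * deriv smoothTransition ((x - c) / ε)) x := by
  have h1 : HasDerivAt (fun x : ℝ ↦ (x - c) / ε) (1 / ε) x :=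
    ((hasDerivAt_id x).sub_const c).div_const ε
  have h2 := ((smoothTransition.contDiff (n := 1)).differentiable one_ne_zero
    ((x - c) / ε)).hasDerivAt.comp x h1
  rw [one_div, mul_comm] at h2
  exact h2

theorem hasCompactSupport_deriv_smoothTransition_scaled (c : ℝ) {ε : ℝ} (hε : 0 < ε) :
    HasCompactSupport fun x ↦ ε⁻¹ * deriv smoothTransition ((x - c) / ε) := by
  refine HasCompactSupport.intro (K := Icc c (c + ε)) isCompact_Icc fun x hx ↦ ?_
  rw [smoothTransition_deriv_eq_zero, mul_zero]
  contrapose! hx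
  rw [mem_Icc, le_div_iff₀ hε, div_le_iff₀ hε] at hx
  constructor <;> linarith [hx.1, hx.2]

/-- Rescaling moves `ε` into the argument of `h`, so the right-hand side makes sense and is
continuous at `ε = 0`. -/
theorem integral_deriv_smoothTransition_scaled_smul {h : ℝ → ℂ} (c : ℝ) {ε : ℝ} (hε : 0 < ε) :
    ∫ x, (ε⁻¹ * deriv smoothTransition ((x - c) / ε)) • h x =
      ∫ s in (0 : ℝ)..1, deriv smoothTransition s • h (c + ε * s) := by
  set G : ℝ → ℂ := fun s ↦ deriv smoothTransition s • h (c + ε * s) with hG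
  have h1 : ∀ x, (ε⁻¹ * deriv smoothTransition ((x - c) / ε)) • h x = ε⁻¹ • G ((x - c) / ε) := by
    intro x
    have : c + ε * ((x - c) / ε) = x := by field_simp; ring
    simp only [hG, this, mul_smul]
  simp_rw [h1]
  rw [integral_smul, integral_sub_right_eq_self (fun x ↦ G (x / ε)) c, Measure.integral_comp_div,
    smul_smul, abs_of_pos hε, inv_mul_cancel₀ hε.ne', one_smul,
    intervalIntegral.integral_of_le zero_le_one, ← integral_Icc_eq_integral_Ioc]
  refine (setIntegral_eq_integral_of_forall_compl_eq_zero fun s hs ↦ ?_).symm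
  simp [hG, smoothTransition_deriv_eq_zero hs]

/-- A continuous function on the line with zero distributional derivative on an open set is constant
on every interval contained in that set. -/
theorem eq_of_forall_integral_deriv_smul_eq_zero {h : ℝ → ℂ} (hh : Continuous h) {U : Set ℝ}
    (hU : IsOpen U)
    (H : ∀ A : ℝ → ℝ, ContDiff ℝ ∞ A → HasCompactSupport A → tsupport A ⊆ U →
      ∫ x, deriv A x • h x = 0)
    {a b : ℝ} (hab : a < b) (habU : Icc a b ⊆ U) : h a = h b := by
  obtain ⟨δ, hδ, hball⟩ := Metric.isOpen_iff.1 hU b (habU (right_mem_Icc.2 hab.le))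
  let D : ℝ → ℂ := fun ε ↦ (∫ s in (0 : ℝ)..1, deriv smoothTransition s • h (a + ε * s)) -
      ∫ s in (0 : ℝ)..1, deriv smoothTransition s • h (b + ε * s)
  have hcont (c : ℝ) : Continuous fun ε : ℝ ↦
      ∫ s in (0 : ℝ)..1, deriv smoothTransition s • h (c + ε * s) := by
    apply intervalIntegral.continuous_parametric_intervalIntegral_of_continuous'
    have := continuous_deriv_smoothTransition
    simp only [Function.uncurry_def]
    fun_prop
  have hD : Continuous D := (hcont a).sub (hcont b)
  have hD0 : ∀ ε ∈ Ioo 0 δ, D ε = 0 := by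
    rintro ε ⟨hε, hεδ⟩
    -- A plateau rising on `[a, a + ε]` and falling on `[b, b + ε]`: testing against its derivative
    -- compares averages of `h` just right of `a` and of `b`. The fall overshoots `b`, hence the
    -- margin `δ`.
    let A : ℝ → ℝ := fun x ↦ smoothTransition ((x - a) / ε) - smoothTransition ((x - b) / ε)
    have hA : ContDiff ℝ ∞ A := by
      have := smoothTransition.contDiff (n := ⊤)
      exact (this.comp (by fun_prop)).sub (this.comp (by fun_prop))
    have hsupp : Function.support A ⊆ Icc a (b + ε) := by
      refine Function.support_subset_iff'.2 fun x hx ↦ ?_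
      rw [mem_Icc, not_and_or, not_le, not_le] at hx
      rcases hx with hx | hx
      · simp only [A]
        rw [smoothTransition.zero_of_nonpos (div_nonpos_of_nonpos_of_nonneg (by linarith) hε.le),
          smoothTransition.zero_of_nonpos (div_nonpos_of_nonpos_of_nonneg (by linarith) hε.le),
          sub_zero]
      · simp only [A]
        rw [smoothTransition.one_of_one_le ((one_le_div hε).2 (by linarith)),
          smoothTransition.one_of_one_le ((one_le_div hε).2 (by linarith)), sub_self]
    have htsupp : tsupport A ⊆ Icc a (b + ε) := closure_minimal hsupp isClosed_Icc
    have key := H A hA (isCompact_Icc.of_isClosed_subset (isClosed_tsupport A) htsupp)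
      (htsupp.trans fun x hx ↦ by
        rcases le_or_gt x b with hxb | hxb
        · exact habU ⟨hx.1, hxb⟩
        · apply hball
          rw [Metric.mem_ball, Real.dist_eq, abs_of_pos (by linarith)]
          linarith [hx.2])
    have hderiv : ∀ x, deriv A x • h x =
        (ε⁻¹ * deriv smoothTransition ((x - a) / ε)) • h x -
        (ε⁻¹ * deriv smoothTransition ((x - b) / ε)) • h x := fun x ↦ by
      have hAx : HasDerivAt A _ x := (hasDerivAt_smoothTransition_scaled a ε x).sub
        (hasDerivAt_smoothTransition_scaled b ε x)
      rw [hAx.deriv, sub_smul]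
    have hint (c : ℝ) : Integrable fun x ↦
        (ε⁻¹ * deriv smoothTransition ((x - c) / ε)) • h x := by
      apply Continuous.integrable_of_hasCompactSupport
      · have := continuous_deriv_smoothTransition
        fun_prop
      · exact (hasCompactSupport_deriv_smoothTransition_scaled c hε).smul_right
    simp_rw [hderiv] at key
    rw [integral_sub (hint a) (hint b), integral_deriv_smoothTransition_scaled_smul a hε,
      integral_deriv_smoothTransition_scaled_smul b hε] at key
    exact key
  have hlim : D 0 = 0 := by
    refine tendsto_nhds_unique (hD.continuousAt.tendsto.mono_left nhdsWithin_le_nhds)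
      (tendsto_const_nhds.congr' (f₁ := fun _ ↦ (0 : ℂ)) (l₁ := 𝓝[>] (0 : ℝ)) ?_)
    filter_upwards [Ioo_mem_nhdsGT hδ] with ε hε using (hD0 ε hε).symm
  have hone : ∫ s in (0 : ℝ)..1, deriv smoothTransition s = 1 := by
    rw [intervalIntegral.integral_deriv_eq_sub
      (fun x _ ↦ (smoothTransition.contDiff (n := 1)).differentiable one_ne_zero x)
      (continuous_deriv_smoothTransition.intervalIntegrable _ _)]
    simp
  simp only [D, zero_mul, add_zero, intervalIntegral.integral_smul_const, hone, one_smul] at hlim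
  exact sub_eq_zero.1 hlim

/-- The fundamental theorem of calculus for continuous functions with a continuous distributional
derivative. -/
theorem sub_eq_intervalIntegral_of_weak_deriv {g k : ℝ → ℂ} (hg : Continuous g)
    (hk : Continuous k) {U : Set ℝ} (hU : IsOpen U)
    (H : ∀ A : ℝ → ℝ, ContDiff ℝ ∞ A → HasCompactSupport A → tsupport A ⊆ U →
      (∫ x, deriv A x • g x) + ∫ x, A x • k x = 0)
    {a b : ℝ} (hab : a < b) (habU : Icc a b ⊆ U) : g b - g a = ∫ x in a..b, k x := by
  let K : ℝ → ℂ := fun x ↦ ∫ t in a..x, k t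
  have hK (x : ℝ) : HasDerivAt K (k x) x := hk.integral_hasStrictDerivAt a x |>.hasDerivAt
  have hKc : Continuous K := continuous_iff_continuousAt.2 fun x ↦ (hK x).continuousAt
  have := eq_of_forall_integral_deriv_smul_eq_zero (hg.sub hKc) hU (fun A hA hAc hAU ↦ ?_) hab habU
  · simp only [K, Pi.sub_apply, intervalIntegral.integral_same, sub_zero] at this
    rw [this]; ring
  have hA' : Continuous (deriv A) := hA.continuous_deriv (by simp)
  have i1 : Integrable fun x ↦ deriv A x • g x :=
    (hA'.smul hg).integrable_of_hasCompactSupport hAc.deriv.smul_right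
  have i2 : Integrable fun x ↦ deriv A x • K x :=
    (hA'.smul hKc).integrable_of_hasCompactSupport hAc.deriv.smul_right
  have i3 : Integrable fun x ↦ A x • k x :=
    (hA.continuous.smul hk).integrable_of_hasCompactSupport hAc.smul_right
  have i4 : Integrable fun x ↦ A x • K x :=
    (hA.continuous.smul hKc).integrable_of_hasCompactSupport hAc.smul_right
  have hparts := integral_eq_zero_of_hasDerivAt_of_integrable
    (fun x ↦ ((hA.differentiable (by simp) x).hasDerivAt.smul (hK x))) (i3.add i2) i4
  rw [integral_add i3 i2] at hparts
  simp only [Pi.sub_apply, smul_sub]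
  rw [integral_sub i1 i2]
  linear_combination H A hA hAc hAU - hparts

/-! ### From the distributional equation to rectangles -/

/-- The weak form of the equation tested against a product. -/
theorem IsDistributionalSolution.integral_prod_eq_zero {Ω : TopologicalSpace.Opens (ℝ × ℝ)}
    {u : ℝ × ℝ → ℂ} (hu : IsDistributionalSolution Ω u) {A B : ℝ → ℝ}
    (hA : ContDiff ℝ ∞ A) (hB : ContDiff ℝ ∞ B)
    (hAc : HasCompactSupport A) (hBc : HasCompactSupport B)
    (hAB : tsupport A ×ˢ tsupport B ⊆ (Ω : Set (ℝ × ℝ))) :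
    (∫ p : ℝ × ℝ, (deriv A p.1 * deriv B p.2) • u p) +
      ∫ p : ℝ × ℝ, (A p.1 * B p.2) • u p = 0 := by
  have hsub : tsupport (fun p : ℝ × ℝ ↦ A p.1 * B p.2) ⊆ tsupport A ×ˢ tsupport B := by
    refine closure_minimal (fun p hp ↦ ?_) ((isClosed_tsupport A).prod (isClosed_tsupport B))
    rw [Function.mem_support] at hp
    exact ⟨subset_tsupport A (left_ne_zero_of_mul hp), subset_tsupport B (right_ne_zero_of_mul hp)⟩
  let φ : 𝓓(Ω, ℝ) :=
    { toFun := fun p ↦ A p.1 * B p.2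
      contDiff' := (hA.comp contDiff_fst).mul (hB.comp contDiff_snd)
      hasCompactSupport' :=
        (hAc.isCompact.prod hBc.isCompact).of_isClosed_subset (isClosed_tsupport _) hsub
      tsupport_subset' := hsub.trans hAB }
  have hφ (p : ℝ × ℝ) : φ p = A p.1 * B p.2 := rfl
  have hdA (x : ℝ) := (hA.differentiable (by simp) x).hasDerivAt
  have hdB (x : ℝ) := (hB.differentiable (by simp) x).hasDerivAt
  have h1 (p : ℝ × ℝ) : (∂_{((1, 0) : ℝ × ℝ)} φ) p = deriv A p.1 * B p.2 := by
    rw [TestFunction.lineDerivOp_eq_lineDerivCLM ℝ, TestFunction.lineDerivCLM_apply_of_le le_top]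
    have : (fun t : ℝ ↦ φ (p + t • ((1, 0) : ℝ × ℝ))) = fun t ↦ A (p.1 + t) * B p.2 := by
      ext t; simp [hφ]
    rw [lineDeriv, this]
    have h := ((hdA (p.1 + 0)).comp_const_add p.1 0).mul_const (B p.2)
    simpa using h.deriv
  have h2 (p : ℝ × ℝ) : (∂_{((0, 1) : ℝ × ℝ)} (∂_{((1, 0) : ℝ × ℝ)} φ)) p =
      deriv A p.1 * deriv B p.2 := by
    rw [TestFunction.lineDerivOp_eq_lineDerivCLM ℝ, TestFunction.lineDerivCLM_apply_of_le le_top]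
    have : (fun t : ℝ ↦ (∂_{((1, 0) : ℝ × ℝ)} φ) (p + t • ((0, 1) : ℝ × ℝ))) =
        fun t ↦ deriv A p.1 * B (p.2 + t) := by
      ext t; rw [h1]; simp
    rw [lineDeriv, this]
    have h := ((hdB (p.2 + 0)).comp_const_add p.2 0).const_mul (deriv A p.1)
    simpa using h.deriv
  have h' : toDistribution Ω u (∂_{((0, 1) : ℝ × ℝ)} (∂_{((1, 0) : ℝ × ℝ)} φ)) +
      toDistribution Ω u φ = 0 := by
    refine Eq.trans ?_ congr($(hu.2) φ)
    change _ = (∂_{((1, 0) : ℝ × ℝ)} (∂_{((0, 1) : ℝ × ℝ)} (toDistribution Ω u))) φ +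
      toDistribution Ω u φ
    -- Each derivative moved onto the test function costs a sign; the two signs cancel.
    rw [Distribution.lineDerivOp_apply_apply, map_neg, Distribution.lineDerivOp_apply_apply,
      map_neg, neg_neg]
  rw [toDistribution_apply hu.1, toDistribution_apply hu.1] at h'
  simpa only [h2, hφ] using h'

theorem continuous_integral_smul_of_hasCompactSupport {B : ℝ → ℝ} {v : ℝ × ℝ → ℂ}
    (hB : Continuous B) (hBc : HasCompactSupport B) (hv : Continuous v) :
    Continuous fun x ↦ ∫ y, B y • v (x, y) := by
  have h : (fun x ↦ ∫ y, B y • v (x, y)) = fun x ↦ ∫ y in tsupport B, B y • v (x, y) := by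
    ext x
    refine (setIntegral_eq_integral_of_forall_compl_eq_zero fun y hy ↦ ?_).symm
    rw [image_eq_zero_of_notMem_tsupport hy, zero_smul]
  rw [h]
  refine continuous_parametric_integral_of_continuous ?_ hBc.isCompact
  simp only [Function.uncurry_def]
  fun_prop

theorem integral_mul_smul_eq_integral_smul_integral_smul {A B : ℝ → ℝ} {v : ℝ × ℝ → ℂ}
    (hA : Continuous A) (hAc : HasCompactSupport A) (hB : Continuous B)
    (hBc : HasCompactSupport B) (hv : Continuous v) :
    ∫ p : ℝ × ℝ, (A p.1 * B p.2) • v p = ∫ x, A x • ∫ y, B y • v (x, y) := by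
  have hint : Integrable fun p : ℝ × ℝ ↦ (A p.1 * B p.2) • v p := by
    refine Continuous.integrable_of_hasCompactSupport (by fun_prop) ?_
    refine HasCompactSupport.intro (hAc.isCompact.prod hBc.isCompact) fun p hp ↦ ?_
    rw [mem_prod, not_and_or] at hp
    rcases hp with hp | hp <;> simp [image_eq_zero_of_notMem_tsupport hp]
  rw [Measure.volume_eq_prod] at hint ⊢
  rw [integral_prod _ hint]
  simp_rw [← integral_smul, mul_smul]

theorem intervalIntegral_integral_smul_swap {B : ℝ → ℝ} {v : ℝ × ℝ → ℂ}
    (hB : Continuous B) (hBc : HasCompactSupport B) (hv : Continuous v) (a b : ℝ) :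
    ∫ x in a..b, ∫ y, B y • v (x, y) = ∫ y, B y • ∫ x in a..b, v (x, y) := by
  rw [intervalIntegral_integral_swap]
  · simp_rw [intervalIntegral.integral_smul]
  have h1 : IntegrableOn (fun p : ℝ × ℝ ↦ B p.2 • v p) (uIcc a b ×ˢ tsupport B) :=
    (Continuous.continuousOn (by fun_prop)).integrableOn_compact
      (isCompact_uIcc.prod hBc.isCompact)
  have h2 : IntegrableOn (fun p : ℝ × ℝ ↦ B p.2 • v p) (Ι a b ×ˢ univ) := by
    refine IntegrableOn.of_forall_sdiff_eq_zero
      (h1.mono_set (prod_mono uIoc_subset_uIcc subset_rfl))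
      (measurableSet_uIoc.prod MeasurableSet.univ) fun p hp ↦ ?_
    have : p.2 ∉ tsupport B := fun h ↦ hp.2 ⟨hp.1.1, h⟩
    rw [image_eq_zero_of_notMem_tsupport this, zero_smul]
  rw [IntegrableOn, Measure.volume_eq_prod, ← Measure.prod_restrict, Measure.restrict_univ] at h2
  exact h2

/-- A continuous distributional solution on a product of open sets satisfies the integrated form of
the equation on every compact rectangle. -/
theorem IsDistributionalSolution.rectangle_eq {Ω : TopologicalSpace.Opens (ℝ × ℝ)} {U V : Set ℝ}
    (hU : IsOpen U) (hV : IsOpen V) (hΩ : (Ω : Set (ℝ × ℝ)) = U ×ˢ V) {u v : ℝ × ℝ → ℂ}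
    (hu : IsDistributionalSolution Ω u) (hv : Continuous v) (huv : EqOn u v Ω)
    {a b c d : ℝ} (hab : a < b) (hcd : c < d) (habU : Icc a b ⊆ U) (hcdV : Icc c d ⊆ V) :
    (v (b, d) - v (a, d)) - (v (b, c) - v (a, c)) = -∫ y in c..d, ∫ x in a..b, v (x, y) := by
  have hInt : Continuous fun y ↦ ∫ x in a..b, v (x, y) := by
    apply intervalIntegral.continuous_parametric_intervalIntegral_of_continuous'
    simp only [Function.uncurry_def]
    fun_prop
  rw [← intervalIntegral.integral_neg]
  -- The weak fundamental theorem is used twice: in `y` here, and for each fixed test function `B`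
  -- in `x` below.
  refine sub_eq_intervalIntegral_of_weak_deriv (g := fun y ↦ v (b, y) - v (a, y))
    (k := fun y ↦ -∫ x in a..b, v (x, y)) (by fun_prop)
    hInt.neg hV (fun B hB hBc hBV ↦ ?_) hcd hcdV
  have hB' : Continuous (deriv B) := hB.continuous_deriv (by simp)
  have hx := sub_eq_intervalIntegral_of_weak_deriv
    (continuous_integral_smul_of_hasCompactSupport hB' hBc.deriv hv)
    (continuous_integral_smul_of_hasCompactSupport hB.continuous hBc hv) hU
    (fun A hA hAc hAU ↦ ?_) hab habU
  · have hint (e : ℝ) : Integrable fun y ↦ deriv B y • v (e, y) :=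
      Continuous.integrable_of_hasCompactSupport (by fun_prop) hBc.deriv.smul_right
    rw [intervalIntegral_integral_smul_swap hB.continuous hBc hv] at hx
    simp_rw [smul_sub, smul_neg]
    rw [integral_sub (hint b) (hint a), integral_neg, hx, add_neg_cancel]
  have hA' : Continuous (deriv A) := hA.continuous_deriv (by simp)
  have hsub : tsupport A ×ˢ tsupport B ⊆ (Ω : Set (ℝ × ℝ)) := hΩ ▸ prod_mono hAU hBV
  rw [← integral_mul_smul_eq_integral_smul_integral_smul hA' hAc.deriv hB' hBc.deriv hv,
    ← integral_mul_smul_eq_integral_smul_integral_smul hA.continuous hAc hB.continuous hBc hv,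
    ← hu.integral_prod_eq_zero hA hB hAc hBc hsub]
  congr 1
  · refine integral_congr_ae (Eventually.of_forall fun p ↦ ?_)
    by_cases hp : p ∈ tsupport A ×ˢ tsupport B
    · simp only [huv (hsub hp)]
    · rw [mem_prod, not_and_or] at hp
      rcases hp with hp | hp
      · simp [image_eq_zero_of_notMem_tsupport fun h ↦ hp (tsupport_deriv_subset h)]
      · simp [image_eq_zero_of_notMem_tsupport fun h ↦ hp (tsupport_deriv_subset h)]
  · refine integral_congr_ae (Eventually.of_forall fun p ↦ ?_)
    by_cases hp : p ∈ tsupport A ×ˢ tsupport B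
    · simp only [huv (hsub hp)]
    · rw [mem_prod, not_and_or] at hp
      rcases hp with hp | hp <;> simp [image_eq_zero_of_notMem_tsupport hp]

/-! ### The Volterra equation in the quarter-plane -/

/-- The extension of a function on the closed quarter-plane to the plane, in the coordinates
`(x, -y)`, that is constant on the normal directions of the quarter-plane. -/
noncomputable def reflectedExtension (u : ℝ × ℝ → ℂ) (x t : ℝ) : ℂ := u (max x 0, -max t 0)

theorem reflectedExtension_apply {u : ℝ × ℝ → ℂ} {x t : ℝ} (hx : 0 ≤ x) (ht : 0 ≤ t) :
    reflectedExtension u x t = u (x, -t) := by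
  rw [reflectedExtension, max_eq_left hx, max_eq_left ht]

theorem continuous_reflectedExtension {u : ℝ × ℝ → ℂ} (hu : ContinuousOn u closedQuarterPlane) :
    Continuous (Function.uncurry (reflectedExtension u)) := by
  refine hu.comp_continuous (f := fun p : ℝ × ℝ ↦ (max p.1 0, -max p.2 0)) (by fun_prop) fun p ↦ ?_
  exact ⟨le_max_right p.1 0, neg_nonpos.2 (le_max_right p.2 0)⟩

/-- The rectangles `[δ, x] × [δ, t]` lie inside the open quarter-plane; continuity up to the
boundary permits `δ → 0`, and the terms on `x = 0` drop out. -/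
theorem IsDistributionalSolution.reflectedExtension_eq {u : ℝ × ℝ → ℂ}
    (hu : IsDistributionalSolution openQuarterPlane u) (hc : ContinuousOn u closedQuarterPlane)
    (hvanish : ∀ y : ℝ, y ≤ 0 → u (0, y) = 0) {x t : ℝ} (hx : 0 ≤ x) (ht : 0 ≤ t) :
    reflectedExtension u x t = reflectedExtension u x 0 +
      ∫ τ in (0 : ℝ)..t, ∫ ξ in (0 : ℝ)..x, reflectedExtension u ξ τ := by
  set w := reflectedExtension u with hw
  have hwc : Continuous (Function.uncurry w) := continuous_reflectedExtension hc
  have hw0 (s : ℝ) : w 0 s = 0 := by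
    rw [hw, reflectedExtension, max_self]
    exact hvanish _ (neg_nonpos.2 (le_max_right _ _))
  rcases hx.eq_or_lt with rfl | hx
  · simp [hw0]
  rcases ht.eq_or_lt with rfl | ht
  · simp
  have key : ∀ δ ∈ Ioo 0 (min x t), (w x δ - w δ δ) - (w x t - w δ t) =
      -∫ τ in δ..t, ∫ ξ in δ..x, w ξ τ := by
    rintro δ ⟨hδ, hδm⟩
    obtain ⟨hδx, hδt⟩ := lt_min_iff.1 hδm
    have := hu.rectangle_eq isOpen_Ioi isOpen_Iio rfl (v := fun p ↦ w p.1 (-p.2))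
      (hwc.comp (by fun_prop : Continuous fun p : ℝ × ℝ ↦ (p.1, -p.2)))
      (fun p hp ↦ by
        have h1 : 0 < p.1 := hp.1
        have h2 : p.2 < 0 := hp.2
        change u p = reflectedExtension u p.1 (-p.2)
        rw [reflectedExtension_apply h1.le (by linarith), neg_neg]) hδx (neg_lt_neg hδt)
      (fun z hz ↦ lt_of_lt_of_le hδ hz.1) (fun z hz ↦ lt_of_le_of_lt hz.2 (neg_lt_zero.2 hδ))
    simp only [neg_neg] at this
    rw [this, intervalIntegral.integral_comp_neg (fun τ ↦ ∫ ξ in δ..x, w ξ τ), neg_neg, neg_neg]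
  have hinner : Continuous fun p : ℝ × ℝ ↦ ∫ ξ in p.1..x, w ξ p.2 := by
    simp_rw [intervalIntegral.integral_symm x]
    refine (intervalIntegral.continuous_parametric_intervalIntegral_of_continuous
      (f := fun (p : ℝ × ℝ) ξ ↦ w ξ p.2) ?_ continuous_fst).neg
    exact hwc.comp (by fun_prop : Continuous fun q : (ℝ × ℝ) × ℝ ↦ (q.2, q.1.2))
  have houter : Continuous fun δ ↦ ∫ τ in δ..t, ∫ ξ in δ..x, w ξ τ := by
    simp_rw [intervalIntegral.integral_symm t]
    exact (intervalIntegral.continuous_parametric_intervalIntegral_of_continuous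
      (f := fun δ τ ↦ ∫ ξ in δ..x, w ξ τ) hinner continuous_id).neg
  have hL : Continuous fun δ ↦ (w x δ - w δ δ) - (w x t - w δ t) := by
    have h (f g : ℝ → ℝ) (hf : Continuous f) (hg : Continuous g) :
        Continuous fun δ ↦ w (f δ) (g δ) := hwc.comp (hf.prodMk hg)
    exact ((h _ _ continuous_const continuous_id).sub (h _ _ continuous_id continuous_id)).sub
      ((h _ _ continuous_const continuous_const).sub (h _ _ continuous_id continuous_const))
  have hlim : (w x 0 - w 0 0) - (w x t - w 0 t) = -∫ τ in (0 : ℝ)..t, ∫ ξ in (0 : ℝ)..x, w ξ τ := by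
    refine tendsto_nhds_unique (hL.continuousAt.tendsto.mono_left
      (nhdsWithin_le_nhds (s := Ioi (0 : ℝ)))) ?_
    refine (houter.neg.continuousAt.tendsto.mono_left nhdsWithin_le_nhds).congr' ?_
    filter_upwards [Ioo_mem_nhdsGT (lt_min hx ht)] with δ hδ using (key δ hδ).symm
  rw [hw0, hw0] at hlim
  linear_combination -hlim

/-! ### Propagation of exponential growth -/

theorem intervalIntegral_exp_mul_le {θ : ℝ} (hθ : 0 < θ) (x : ℝ) :
    ∫ ξ in (0 : ℝ)..x, exp (θ * ξ) ≤ exp (θ * x) / θ := by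
  rw [intervalIntegral.integral_comp_mul_left (fun ξ ↦ exp ξ) hθ.ne', integral_exp, smul_eq_mul,
    div_eq_inv_mul]
  gcongr
  simp

theorem norm_intervalIntegral_le_of_norm_le_exp {f : ℝ → ℂ} {M θ x : ℝ} (hθ : 0 < θ) (hx : 0 ≤ x)
    (hM : 0 ≤ M) (hf : ∀ ξ ∈ Icc 0 x, ‖f ξ‖ ≤ M * exp (θ * ξ)) :
    ‖∫ ξ in (0 : ℝ)..x, f ξ‖ ≤ M * (exp (θ * x) / θ) := by
  calc ‖∫ ξ in (0 : ℝ)..x, f ξ‖ ≤ ∫ ξ in (0 : ℝ)..x, M * exp (θ * ξ) :=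
        intervalIntegral.norm_integral_le_of_norm_le hx
          (Eventually.of_forall fun ξ hξ ↦ hf ξ (Ioc_subset_Icc_self hξ))
          (Continuous.intervalIntegrable (by fun_prop) _ _)
    _ = M * ∫ ξ in (0 : ℝ)..x, exp (θ * ξ) := intervalIntegral.integral_const_mul _ _
    _ ≤ _ := by gcongr; exact intervalIntegral_exp_mul_le hθ x

/-- Exponential growth of the Goursat data propagates to the solution. -/
theorem norm_le_of_volterra {w : ℝ → ℝ → ℂ} (hwc : Continuous (Function.uncurry w))
    (hw : ∀ x t, 0 ≤ x → 0 ≤ t →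
      w x t = w x 0 + ∫ τ in (0 : ℝ)..t, ∫ ξ in (0 : ℝ)..x, w ξ τ)
    {C θ : ℝ} (hθ : 0 < θ) (hC : ∀ x, 0 ≤ x → ‖w x 0‖ ≤ C * exp (θ * x))
    {x t : ℝ} (hx : 0 ≤ x) (ht : 0 ≤ t) :
    ‖w x t‖ ≤ 2 * C * exp (2 / θ * t) * exp (θ * x) := by
  have hC0 : 0 ≤ C := by simpa using (norm_nonneg _).trans (hC 0 le_rfl)
  have hκ : 0 < 2 / θ := by positivity
  -- The Volterra operator is a contraction in the weighted sup norm, so the equation is evaluated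
  -- where that norm is attained.
  obtain ⟨⟨a, b⟩, ⟨ha, hb⟩, hmax⟩ :=
    (isCompact_Icc.prod isCompact_Icc : IsCompact (Icc 0 x ×ˢ Icc 0 t)).exists_isMaxOn
      (f := fun p : ℝ × ℝ ↦ ‖Function.uncurry w p‖ * exp (-(2 / θ * p.2 + θ * p.1)))
      ⟨(x, t), ⟨hx, le_rfl⟩, ⟨ht, le_rfl⟩⟩ (Continuous.continuousOn (by fun_prop))
  simp only at ha hb
  set M := ‖w a b‖ * exp (-(2 / θ * b + θ * a)) with hM
  have hM0 : 0 ≤ M := by positivity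
  have hbound : ∀ ξ ∈ Icc 0 x, ∀ τ ∈ Icc 0 t,
      ‖w ξ τ‖ ≤ M * exp (2 / θ * τ) * exp (θ * ξ) := by
    intro ξ hξ τ hτ
    have h : ‖w ξ τ‖ * exp (-(2 / θ * τ + θ * ξ)) ≤ M := hmax (a := (ξ, τ)) ⟨hξ, hτ⟩
    rw [exp_neg, ← div_eq_mul_inv, div_le_iff₀ (exp_pos _), exp_add, ← mul_assoc] at h
    exact h
  have hinner : ∀ τ ∈ Icc 0 b,
      ‖∫ ξ in (0 : ℝ)..a, w ξ τ‖ ≤ M * (exp (θ * a) / θ) * exp (2 / θ * τ) := by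
    intro τ hτ
    refine (norm_intervalIntegral_le_of_norm_le_exp hθ ha.1 (by positivity) fun ξ hξ ↦
      hbound ξ ⟨hξ.1, hξ.2.trans ha.2⟩ τ ⟨hτ.1, hτ.2.trans hb.2⟩).trans_eq (by ring)
  have houter := norm_intervalIntegral_le_of_norm_le_exp hκ hb.1 (by positivity) hinner
  have hab : ‖w a b‖ ≤ C * exp (θ * a) + M * (exp (θ * a) / θ) * (exp (2 / θ * b) / (2 / θ)) := by
    rw [hw a b ha.1 hb.1]
    exact (norm_add_le _ _).trans (add_le_add (hC a ha.1) houter)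
  have hMeq : ‖w a b‖ = M * (exp (2 / θ * b) * exp (θ * a)) := by
    rw [hM, ← exp_add, mul_assoc, ← exp_add, neg_add_cancel, exp_zero, mul_one]
  have h1 : 1 ≤ exp (2 / θ * b) := one_le_exp (mul_nonneg hκ.le hb.1)
  -- The two integrations gain `1/θ` and `θ/2`: the rate `2/θ` makes the contraction factor `1/2`,
  -- so `M ≤ C + M/2`.
  have hM2 : M ≤ 2 * C := by
    rw [hMeq] at hab
    have e : M * (exp (θ * a) / θ) * (exp (2 / θ * b) / (2 / θ)) =
        M / 2 * (exp (2 / θ * b) * exp (θ * a)) := by field_simp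
    rw [e] at hab
    have h2 : C * exp (θ * a) ≤ C * (exp (2 / θ * b) * exp (θ * a)) := by
      gcongr
      exact le_mul_of_one_le_left (exp_pos _).le h1
    have h3 : M * (exp (2 / θ * b) * exp (θ * a)) ≤
        (C + M / 2) * (exp (2 / θ * b) * exp (θ * a)) := by linarith
    linarith [le_of_mul_le_mul_right h3 (by positivity)]
  refine (hbound x ⟨hx, le_rfl⟩ t ⟨ht, le_rfl⟩).trans ?_
  gcongr

/-! ### The Laplace transform in the space variable -/

theorem integrableOn_exp_smul {f : ℝ → ℂ} (hf : Continuous f) {M θ s : ℝ} (hs : θ < s)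
    (hM : ∀ x, 0 ≤ x → ‖f x‖ ≤ M * exp (θ * x)) :
    IntegrableOn (fun x ↦ exp (-(s * x)) • f x) (Ioi 0) := by
  refine Integrable.mono' ((integrableOn_exp_mul_Ioi (a := θ - s) (by linarith) 0).const_mul M)
    (Continuous.aestronglyMeasurable (by fun_prop)) ?_
  filter_upwards [ae_restrict_mem measurableSet_Ioi] with x hx
  rw [norm_smul, norm_of_nonneg (exp_pos _).le]
  calc exp (-(s * x)) * ‖f x‖ ≤ exp (-(s * x)) * (M * exp (θ * x)) := by
        gcongr; exact hM x (le_of_lt hx)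
    _ = M * exp ((θ - s) * x) := by
        rw [mul_left_comm, ← exp_add]; ring_nf

theorem norm_integral_exp_smul_le {f : ℝ → ℂ} {M θ s : ℝ} (hs : θ < s)
    (hM : ∀ x, 0 ≤ x → ‖f x‖ ≤ M * exp (θ * x)) :
    ‖∫ x in Ioi 0, exp (-(s * x)) • f x‖ ≤ M / (s - θ) := by
  have h : ∫ x in Ioi 0, M * exp ((θ - s) * x) = M / (s - θ) := by
    rw [integral_const_mul, integral_exp_mul_Ioi (by linarith), mul_zero, exp_zero,
      ← neg_sub s θ, neg_div_neg_eq, mul_one_div]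
  rw [← h]
  refine norm_integral_le_of_norm_le
    ((integrableOn_exp_mul_Ioi (a := θ - s) (by linarith) 0).const_mul M) ?_
  filter_upwards [ae_restrict_mem measurableSet_Ioi] with x hx
  rw [norm_smul, norm_of_nonneg (exp_pos _).le]
  calc exp (-(s * x)) * ‖f x‖ ≤ exp (-(s * x)) * (M * exp (θ * x)) := by
        gcongr; exact hM x (le_of_lt hx)
    _ = M * exp ((θ - s) * x) := by
        rw [mul_left_comm, ← exp_add]; ring_nf

theorem hasDerivAt_exp_neg_mul_smul {P : ℝ → ℂ} {p : ℂ} {x : ℝ} (s : ℝ) (hP : HasDerivAt P p x) :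
    HasDerivAt (fun x ↦ exp (-(s * x)) • P x)
      (exp (-(s * x)) • p - s • exp (-(s * x)) • P x) x := by
  have he : HasDerivAt (fun x : ℝ ↦ exp (-(s * x))) (exp (-(s * x)) * -(s * 1)) x :=
    ((hasDerivAt_id x).const_mul s).neg.exp
  refine (he.smul hP).congr_deriv ?_
  rw [smul_smul, sub_eq_add_neg, ← neg_smul]
  ring_nf

/-- The Laplace transform turns the primitive into division by the spectral parameter. -/
theorem integral_exp_smul_primitive {f : ℝ → ℂ} (hf : Continuous f) {M θ s : ℝ} (hθ : 0 < θ)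
    (hs : θ < s) (hM : ∀ x, 0 ≤ x → ‖f x‖ ≤ M * exp (θ * x)) :
    ∫ x in Ioi 0, exp (-(s * x)) • ∫ ξ in (0 : ℝ)..x, f ξ =
      s⁻¹ • ∫ x in Ioi 0, exp (-(s * x)) • f x := by
  have hM0 : 0 ≤ M := by simpa using (norm_nonneg _).trans (hM 0 le_rfl)
  have hs0 : s ≠ 0 := (hθ.trans hs).ne'
  let P : ℝ → ℂ := fun x ↦ ∫ ξ in (0 : ℝ)..x, f ξ
  have hP (x : ℝ) : HasDerivAt P (f x) x := (hf.integral_hasStrictDerivAt 0 x).hasDerivAt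
  have hPc : Continuous P := continuous_iff_continuousAt.2 fun x ↦ (hP x).continuousAt
  have hPb : ∀ x, 0 ≤ x → ‖P x‖ ≤ M / θ * exp (θ * x) := fun x hx ↦
    (norm_intervalIntegral_le_of_norm_le_exp hθ hx hM0 fun ξ hξ ↦ hM ξ hξ.1).trans_eq (by ring)
  have i1 := integrableOn_exp_smul hf hs hM
  have i2 := integrableOn_exp_smul hPc hs hPb
  have hd (x : ℝ) : HasDerivAt (fun x ↦ exp (-(s * x)) • P x)
      (exp (-(s * x)) • f x - s • exp (-(s * x)) • P x) x :=
    hasDerivAt_exp_neg_mul_smul s (hP x)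
  have hlim : Tendsto (fun x ↦ exp (-(s * x)) • P x) atTop (𝓝 0) := by
    have h0 : Tendsto (fun x ↦ M / θ * exp (-((s - θ) * x))) atTop (𝓝 0) := by
      rw [← mul_zero (M / θ)]
      exact (tendsto_exp_neg_atTop_nhds_zero.comp
        (tendsto_id.const_mul_atTop (sub_pos.2 hs))).const_mul _
    refine squeeze_zero_norm' ?_ h0
    filter_upwards [eventually_ge_atTop 0] with x hx
    rw [norm_smul, norm_of_nonneg (exp_pos _).le]
    calc exp (-(s * x)) * ‖P x‖ ≤ exp (-(s * x)) * (M / θ * exp (θ * x)) := by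
          gcongr; exact hPb x hx
      _ = M / θ * exp (-((s - θ) * x)) := by
          rw [mul_left_comm, ← exp_add]; ring_nf
  have key := integral_Ioi_of_hasDerivAt_of_tendsto (a := 0) (hd 0).continuousAt.continuousWithinAt
    (fun x _ ↦ hd x) (i1.sub (i2.smul s)) hlim
  have i3 : IntegrableOn (fun x ↦ s • exp (-(s * x)) • P x) (Ioi 0) := i2.smul s
  rw [integral_sub i1 i3, integral_smul] at key
  simp only [P, intervalIntegral.integral_same, smul_zero, sub_zero] at key
  rw [sub_eq_zero.1 key, smul_smul, inv_mul_cancel₀ hs0, one_smul]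

/-- The Laplace transform in `x` of a solution of the Volterra equation solves an ordinary
differential equation in `t`. -/
theorem integral_exp_smul_eq_of_volterra {w : ℝ → ℝ → ℂ} (hwc : Continuous (Function.uncurry w))
    (hw : ∀ x t, 0 ≤ x → 0 ≤ t →
      w x t = w x 0 + ∫ τ in (0 : ℝ)..t, ∫ ξ in (0 : ℝ)..x, w ξ τ)
    {K κ θ s : ℝ} (hκ : 0 < κ) (hθ : 0 < θ) (hs : θ < s)
    (hK : ∀ x t, 0 ≤ x → 0 ≤ t → ‖w x t‖ ≤ K * exp (κ * t) * exp (θ * x)) {T : ℝ} (hT : 0 ≤ T) :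
    ∫ x in Ioi 0, exp (-(s * x)) • w x T =
      exp (s⁻¹ * T) • ∫ x in Ioi 0, exp (-(s * x)) • w x 0 := by
  have hK0 : 0 ≤ K := by simpa using (norm_nonneg _).trans (hK 0 0 le_rfl le_rfl)
  have hsec (t : ℝ) : Continuous fun x ↦ w x t :=
    hwc.comp (by fun_prop : Continuous fun x : ℝ ↦ (x, t))
  let h : ℝ → ℂ := fun t ↦ ∫ x in Ioi 0, exp (-(s * x)) • w x t
  -- Clamping time to `[0, T]` gives one dominating function for all `t`, so `h ∘ c` is continuous
  -- on the whole line.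
  let c : ℝ → ℝ := fun t ↦ max 0 (min t T)
  have hc : Continuous c := by fun_prop
  have hcT (t : ℝ) : c t ≤ T := max_le hT (min_le_right _ _)
  have hc0 (t : ℝ) : 0 ≤ c t := le_max_left _ _
  have hceq : ∀ t ∈ Icc 0 T, c t = t := fun t ht ↦ by
    simp only [c]; rw [min_eq_left ht.2, max_eq_right ht.1]
  have hKT : ∀ x t, 0 ≤ x → t ∈ Icc 0 T → ‖w x t‖ ≤ K * exp (κ * T) * exp (θ * x) := by
    intro x t hx ht
    refine (hK x t hx ht.1).trans ?_
    gcongr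
    exact ht.2
  have hbd : Integrable (fun x ↦ K * exp (κ * T) * exp ((θ - s) * x)) (volume.restrict (Ioi 0)) :=
    (integrableOn_exp_mul_Ioi (a := θ - s) (by linarith) 0).const_mul _
  have hexp (x : ℝ) : exp (-(s * x)) * exp (θ * x) = exp ((θ - s) * x) := by
    rw [← exp_add]; ring_nf
  have hhc : Continuous fun t ↦ h (c t) := by
    refine continuous_of_dominated (fun t ↦ ?_) (fun t ↦ ?_) hbd
      (Eventually.of_forall fun x ↦ ?_)
    · have := hsec (c t)
      exact Continuous.aestronglyMeasurable (by fun_prop)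
    · filter_upwards [ae_restrict_mem measurableSet_Ioi] with x hx
      rw [norm_smul, norm_of_nonneg (exp_pos _).le, ← hexp, mul_left_comm]
      gcongr
      exact hKT x _ (le_of_lt hx) ⟨hc0 t, hcT t⟩
    · have : Continuous fun t ↦ w x (c t) :=
        hwc.comp (by fun_prop : Continuous fun t : ℝ ↦ (x, c t))
      exact this.const_smul (exp (-(s * x)))
  let W : ℝ → ℝ → ℂ := fun τ x ↦ ∫ ξ in (0 : ℝ)..x, w ξ τ
  have hWc : Continuous (Function.uncurry W) :=
    intervalIntegral.continuous_parametric_intervalIntegral_of_continuous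
      (f := fun (p : ℝ × ℝ) ξ ↦ w ξ p.1)
      (hwc.comp (by fun_prop : Continuous fun q : (ℝ × ℝ) × ℝ ↦ (q.2, q.1.1))) continuous_snd
  have hWb : ∀ τ ∈ Icc 0 T, ∀ x, 0 ≤ x → ‖W τ x‖ ≤ K * exp (κ * T) / θ * exp (θ * x) := by
    intro τ hτ x hx
    exact (norm_intervalIntegral_le_of_norm_le_exp hθ hx (by positivity) fun ξ hξ ↦
      hKT ξ τ hξ.1 hτ).trans_eq (by ring)
  have hvolt : ∀ t ∈ Icc 0 T, h t = h 0 + ∫ τ in (0 : ℝ)..t, s⁻¹ • h (c τ) := by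
    intro t ht
    have hint : Integrable (Function.uncurry fun τ x ↦ exp (-(s * x)) • W τ x)
        ((volume.restrict (Ι 0 t)).prod (volume.restrict (Ioi 0))) := by
      have : IsFiniteMeasure (volume.restrict (Ι (0 : ℝ) t)) :=
        ⟨by simp [uIoc]⟩
      refine Integrable.mono' ((hbd.const_mul θ⁻¹).comp_snd (volume.restrict (Ι 0 t))) ?_ ?_
      · exact Continuous.aestronglyMeasurable (by fun_prop)
      · rw [Measure.prod_restrict]
        filter_upwards [ae_restrict_mem (measurableSet_uIoc.prod measurableSet_Ioi)]
          with p hp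
        rw [uIoc_of_le ht.1] at hp
        rw [Function.uncurry, norm_smul, norm_of_nonneg (exp_pos _).le, ← hexp]
        calc exp (-(s * p.2)) * ‖W p.1 p.2‖
            ≤ exp (-(s * p.2)) * (K * exp (κ * T) / θ * exp (θ * p.2)) := by
              gcongr
              exact hWb p.1 ⟨hp.1.1.le, hp.1.2.trans ht.2⟩ p.2 (le_of_lt hp.2)
          _ = _ := by ring
    have hswap := intervalIntegral_integral_swap hint
    have hpart : ∫ τ in (0 : ℝ)..t, ∫ x in Ioi 0, exp (-(s * x)) • W τ x =
        ∫ τ in (0 : ℝ)..t, s⁻¹ • h (c τ) := by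
      refine intervalIntegral.integral_congr fun τ hτ ↦ ?_
      rw [uIcc_of_le ht.1] at hτ
      have hτT : τ ∈ Icc 0 T := ⟨hτ.1, hτ.2.trans ht.2⟩
      simp only [hceq τ hτT]
      exact integral_exp_smul_primitive (hsec τ) hθ hs fun x hx ↦ hKT x τ hx hτT
    have i0 : IntegrableOn (fun x ↦ exp (-(s * x)) • w x 0) (Ioi 0) :=
      integrableOn_exp_smul (hsec 0) hs fun x hx ↦ hKT x 0 hx ⟨le_rfl, hT⟩
    have it : IntegrableOn (fun x ↦ exp (-(s * x)) • w x t) (Ioi 0) :=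
      integrableOn_exp_smul (hsec t) hs fun x hx ↦ hKT x t hx ht
    rw [← hpart, hswap, ← sub_eq_iff_eq_add', ← integral_sub it i0]
    refine setIntegral_congr_fun measurableSet_Ioi fun x hx ↦ ?_
    rw [hw x t (le_of_lt hx) ht.1, intervalIntegral.integral_smul, smul_add, add_sub_cancel_left]
  let H : ℝ → ℂ := fun t ↦ h 0 + ∫ τ in (0 : ℝ)..t, s⁻¹ • h (c τ)
  have hH (t : ℝ) : HasDerivAt H (s⁻¹ • h (c t)) t :=
    (((hhc.const_smul s⁻¹).integral_hasStrictDerivAt 0 t).hasDerivAt).const_add _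
  -- Integrating factor: the derivative vanishes on `[0, T)`, where `h ∘ c` and `H` agree.
  have hG (t : ℝ) : HasDerivAt (fun t ↦ exp (-(s⁻¹ * t)) • H t)
      (exp (-(s⁻¹ * t)) • (s⁻¹ • (h (c t) - H t))) t := by
    refine (hasDerivAt_exp_neg_mul_smul s⁻¹ (hH t)).congr_deriv ?_
    rw [smul_sub, smul_sub, smul_comm s⁻¹ _ (H t)]
  have hconst := constant_of_has_deriv_right_zero (a := 0) (b := T)
    (fun t _ ↦ (hG t).continuousAt.continuousWithinAt) (fun t ht ↦ by
      have htT : t ∈ Icc 0 T := Ico_subset_Icc_self ht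
      have := (hG t).hasDerivWithinAt (s := Ici t)
      rwa [hceq t htT, show H t = h t from (hvolt t htT).symm, sub_self, smul_zero, smul_zero]
        at this) T ⟨hT, le_rfl⟩
  simp only [mul_zero, neg_zero, exp_zero, one_smul] at hconst
  have hH0 : H 0 = h 0 := by simp [H]
  rw [show H T = h T from (hvolt T ⟨hT, le_rfl⟩).symm, hH0] at hconst
  change h T = exp (s⁻¹ * T) • h 0
  rw [← hconst, smul_smul, ← exp_add, add_neg_cancel, exp_zero, one_smul]

/-! ### Injectivity of the Laplace transform -/

/-- The one-sided Laplace transform of a function of exponential growth `θ` is holomorphic on the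
half-plane `θ < re z`. -/
theorem differentiableAt_laplace {f : ℝ → ℂ} (hf : Continuous f) {M θ : ℝ}
    (hM : ∀ x, 0 ≤ x → ‖f x‖ ≤ M * exp (θ * x)) {z : ℂ} (hz : θ < z.re) :
    DifferentiableAt ℂ (fun z : ℂ ↦ ∫ x in Ioi (0 : ℝ), Complex.exp (-(z * x)) * f x) z := by
  have hM0 : 0 ≤ M := by simpa using (norm_nonneg _).trans (hM 0 le_rfl)
  -- The gap is split in three: one `δ` for the ball around `z`, one to absorb the factor `x` from
  -- differentiation, one for decay.
  set δ := (z.re - θ) / 3 with hδ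
  have hδ0 : 0 < δ := by rw [hδ]; linarith
  have hnorm (z : ℂ) (x : ℝ) : ‖Complex.exp (-(z * x))‖ = exp (-(z.re * x)) := by
    rw [Complex.norm_exp]; simp
  have hcont (z : ℂ) : Continuous fun x : ℝ ↦ Complex.exp (-(z * x)) * f x := by fun_prop
  have hcont' (z : ℂ) : Continuous fun x : ℝ ↦ Complex.exp (-(z * x)) * -(x : ℂ) * f x := by
    fun_prop
  have hint : Integrable (fun x : ℝ ↦ Complex.exp (-(z * x)) * f x)
      (volume.restrict (Ioi 0)) := by
    refine Integrable.mono (integrableOn_exp_smul hf hz hM) (hcont z).aestronglyMeasurable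
      (Eventually.of_forall fun x ↦ ?_)
    rw [norm_mul, hnorm, norm_smul, norm_of_nonneg (exp_pos _).le]
  refine (hasDerivAt_integral_of_dominated_loc_of_deriv_le
    (F' := fun (z : ℂ) (x : ℝ) ↦ Complex.exp (-(z * x)) * -(x : ℂ) * f x)
    (bound := fun x ↦ M / δ * exp (-δ * x)) (Metric.ball_mem_nhds z hδ0)
    (Eventually.of_forall fun z ↦ (hcont z).aestronglyMeasurable) hint
    (hcont' z).aestronglyMeasurable ?_
    ((integrableOn_exp_mul_Ioi (neg_lt_zero.2 hδ0) 0).const_mul _) ?_).2.differentiableAt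
  · filter_upwards [ae_restrict_mem measurableSet_Ioi] with x (hx : 0 < x) y hy
    have hre : θ + 2 * δ ≤ y.re := by
      rw [Metric.mem_ball, dist_eq_norm] at hy
      have := (Complex.abs_re_le_norm (y - z)).trans hy.le
      rw [Complex.sub_re, abs_le] at this
      linarith [this.1]
    have hxδ : x ≤ exp (δ * x) / δ := by
      rw [le_div_iff₀ hδ0]
      linarith [add_one_le_exp (δ * x)]
    rw [norm_mul, norm_mul, hnorm, norm_neg, Complex.norm_real, norm_of_nonneg hx.le]
    calc exp (-(y.re * x)) * x * ‖f x‖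
        ≤ exp (-((θ + 2 * δ) * x)) * (exp (δ * x) / δ) * (M * exp (θ * x)) := by
          gcongr
          exact hM x hx.le
      _ = M / δ * (exp (-((θ + 2 * δ) * x)) * exp (δ * x) * exp (θ * x)) := by ring
      _ = M / δ * exp (-δ * x) := by
          rw [← exp_add, ← exp_add]; ring_nf
  · refine Eventually.of_forall fun x y _ ↦ ?_
    have h1 : HasDerivAt (fun y : ℂ ↦ -(y * x)) (-(1 * (x : ℂ))) y :=
      ((hasDerivAt_id y).mul_const (x : ℂ)).neg
    rw [one_mul] at h1
    exact h1.cexp.mul_const (f x)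

/-- A continuous function on the half-line vanishes if its Laplace transform vanishes on an
interval of the real axis. -/
theorem eq_zero_of_laplace_eq_zero {f : ℝ → ℂ} (hf : Continuous f) (hf0 : ∀ x ≤ 0, f x = 0)
    {M θ b : ℝ} (hM : ∀ x, 0 ≤ x → ‖f x‖ ≤ M * exp (θ * x)) (hb : θ < b)
    (hL : ∀ s ∈ Ioo θ b, ∫ x in Ioi 0, exp (-(s * x)) • f x = 0) : f = 0 := by
  let F : ℂ → ℂ := fun z ↦ ∫ x in Ioi (0 : ℝ), Complex.exp (-(z * x)) * f x
  let U : Set ℂ := {z | θ < z.re}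
  have hU : IsOpen U := isOpen_lt continuous_const Complex.continuous_re
  have hF : AnalyticOnNhd ℂ F U := DifferentiableOn.analyticOnNhd
    (fun z hz ↦ (differentiableAt_laplace hf hM hz).differentiableWithinAt) hU
  have hFreal : ∀ s ∈ Ioo θ b, F s = 0 := by
    intro s hs
    rw [← hL s hs]
    refine integral_congr_ae (Eventually.of_forall fun x ↦ ?_)
    simp [Complex.real_smul]
  obtain ⟨σ, hσ⟩ := exists_between hb
  have hfreq : ∃ᶠ z in 𝓝[≠] (σ : ℂ), F z = 0 := by
    have ht : Tendsto (fun r : ℝ ↦ (r : ℂ)) (𝓝[≠] σ) (𝓝[≠] (σ : ℂ)) :=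
      Complex.continuous_ofReal.continuousAt.continuousWithinAt.tendsto_nhdsWithin
        fun r hr h ↦ hr (Complex.ofReal_injective h)
    refine ht.frequently (Eventually.frequently ?_)
    filter_upwards [nhdsWithin_le_nhds (Ioo_mem_nhds hσ.1 hσ.2)] with r hr using hFreal r hr
  have hFU : EqOn F 0 U := hF.eqOn_zero_of_preconnected_of_frequently_eq_zero
    (convex_halfSpace_re_gt θ).isPreconnected (z₀ := (σ : ℂ)) hσ.1 hfreq
  let p : ℝ → ℂ := fun x ↦ exp (-(σ * x)) • f x
  have hp : Continuous p := by fun_prop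
  have hp0 : ∀ x ∉ Ioi (0 : ℝ), p x = 0 := fun x hx ↦ by
    simp [p, hf0 x (not_lt.1 hx)]
  have hpint : Integrable p :=
    (integrableOn_exp_smul hf hσ.1 hM).integrable_of_forall_notMem_eq_zero hp0
  -- The Fourier transform of `p` is the Laplace transform of `f` along the vertical line `re z =
  -- σ`, where `F` vanishes.
  have hFp : 𝓕 p = 0 := by
    ext ξ
    have hFσ : F ((σ : ℂ) + 2 * π * ξ * Complex.I) = 0 := hFU (by simpa [U] using hσ.1)
    have hres := setIntegral_eq_integral_of_forall_compl_eq_zero (μ := volume) (s := Ioi (0 : ℝ))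
      (f := fun x ↦ Complex.exp (↑(-2 * π * inner ℝ x ξ) * Complex.I) • p x)
      fun x hx ↦ by rw [hp0 x hx, smul_zero]
    rw [Real.fourier_eq', Pi.zero_apply, ← hFσ, ← hres]
    refine integral_congr_ae (Eventually.of_forall fun x ↦ ?_)
    simp only [p, smul_eq_mul, Complex.real_smul, RCLike.inner_apply, conj_trivial]
    rw [← mul_assoc, Complex.ofReal_exp, ← Complex.exp_add]
    push_cast
    ring_nf
  have hinv := hp.fourierInv_fourier_eq hpint (by rw [hFp]; exact integrable_zero _ _ _)
  have hp_zero : p = 0 := by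
    rw [← hinv, hFp]
    ext ξ
    simp [Real.fourierInv_eq']
  ext x
  have := congr_fun hp_zero x
  simpa [p] using this

/-! ### Vanishing of the data and conclusion -/

/-- The Laplace transform of the data of a Volterra solution with sub-critical growth along an
unbounded set of times vanishes. -/
theorem integral_exp_smul_eq_zero_of_volterra {w : ℝ → ℝ → ℂ}
    (hwc : Continuous (Function.uncurry w))
    (hw : ∀ x t, 0 ≤ x → 0 ≤ t →
      w x t = w x 0 + ∫ τ in (0 : ℝ)..t, ∫ ξ in (0 : ℝ)..x, w ξ τ)
    {K κ C θ η s : ℝ} (hκ : 0 < κ) (hθ : 0 < θ) (hs : θ < s) (hη : η < s⁻¹)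
    (hK : ∀ x t, 0 ≤ x → 0 ≤ t → ‖w x t‖ ≤ K * exp (κ * t) * exp (θ * x))
    (hC : ∃ᶠ t in atTop, ∀ x, 0 ≤ x → ‖w x t‖ ≤ C * exp (η * t) * exp (θ * x)) :
    ∫ x in Ioi 0, exp (-(s * x)) • w x 0 = 0 := by
  set F := ∫ x in Ioi 0, exp (-(s * x)) • w x 0 with hF
  have hfreq : ∃ᶠ t in atTop, ‖F‖ ≤ C / (s - θ) * exp (-((s⁻¹ - η) * t)) := by
    -- At such times `exp(t/s) ‖F‖` is at most a constant times `exp(ηt)`, and `η < 1/s` forces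
    -- decay.
    refine (hC.and_eventually (eventually_ge_atTop 0)).mono fun t ⟨ht, ht0⟩ ↦ ?_
    have h := norm_integral_exp_smul_le hs ht
    rw [integral_exp_smul_eq_of_volterra hwc hw hκ hθ hs hK ht0, ← hF, norm_smul,
      norm_of_nonneg (exp_pos _).le] at h
    have e : exp (-((s⁻¹ - η) * t)) = exp (η * t) / exp (s⁻¹ * t) := by
      rw [← exp_sub]; ring_nf
    rw [e, ← mul_div_assoc, le_div_iff₀ (exp_pos _), mul_comm]
    exact h.trans_eq (by ring)
  have hlim : Tendsto (fun t ↦ C / (s - θ) * exp (-((s⁻¹ - η) * t))) atTop (𝓝 0) := by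
    rw [← mul_zero (C / (s - θ))]
    exact (tendsto_exp_neg_atTop_nhds_zero.comp
      (tendsto_id.const_mul_atTop (sub_pos.2 hη))).const_mul _
  exact norm_le_zero_iff.1 (ge_of_tendsto_of_frequently hlim hfreq)

end KleinGordon

theorem theorem1p9 (u : ℝ × ℝ → ℂ) (Y : Set ℝ) (θ₁ θ₂ : ℝ)
    (hcont : ContinuousOn u KleinGordon.closedQuarterPlane)
    (hsol : KleinGordon.IsDistributionalSolution KleinGordon.openQuarterPlane u)
    (hvanish : ∀ y : ℝ, y ≤ 0 → u (0, y) = 0)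
    (hY : Y ⊆ Iic 0) (hY0 : (0 : ℝ) ∈ Y) (hYinf : ¬ BddBelow Y)
    (hθ₁ : 0 < θ₁) (hθ₂ : 0 < θ₂)
    (hgrowth : u =O[𝓟 (Ici (0 : ℝ) ×ˢ Y)]
      fun p : ℝ × ℝ => Real.exp (θ₁ * p.1 + θ₂ * |p.2|))
    (hθ : θ₁ * θ₂ < 1) :
    ∀ x y : ℝ, 0 ≤ x → y ≤ 0 → u (x, y) = 0 := by
  set w := KleinGordon.reflectedExtension u with hw_def
  have hwc : Continuous (Function.uncurry w) := KleinGordon.continuous_reflectedExtension hcont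
  have hw : ∀ x t, 0 ≤ x → 0 ≤ t → w x t = w x 0 + ∫ τ in (0 : ℝ)..t, ∫ ξ in (0 : ℝ)..x, w ξ τ :=
    fun x t hx ht ↦ hsol.reflectedExtension_eq hcont hvanish hx ht
  obtain ⟨C, hC⟩ := isBigO_principal.1 hgrowth
  have hwY : ∀ t, -t ∈ Y → ∀ x, 0 ≤ x →
      ‖w x t‖ ≤ C * Real.exp (θ₂ * t) * Real.exp (θ₁ * x) := by
    intro t ht x hx
    have ht0 : 0 ≤ t := neg_nonpos.1 (hY ht)
    have h := hC (x, -t) ⟨hx, ht⟩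
    simp only at h
    rw [abs_neg, abs_of_nonneg ht0, Real.norm_of_nonneg (Real.exp_pos _).le, add_comm, Real.exp_add,
      ← mul_assoc] at h
    rwa [hw_def, KleinGordon.reflectedExtension_apply hx ht0]
  have hdata : ∀ x, 0 ≤ x → ‖w x 0‖ ≤ C * Real.exp (θ₁ * x) := fun x hx ↦ by
    simpa using hwY 0 (by simpa using hY0) x hx
  have hwzero : (fun x ↦ w x 0) = 0 := by
    -- The upper end `θ₂⁻¹` is the value of `s` at which the rate `1/s` drops to `θ₂`.
    refine KleinGordon.eq_zero_of_laplace_eq_zero (b := θ₂⁻¹)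
      (hwc.comp (by fun_prop : Continuous fun x : ℝ ↦ (x, (0 : ℝ)))) (fun x hx ↦ ?_) hdata
      ((lt_inv_comm₀ hθ₁ hθ₂).2 ?_) fun s hs ↦ ?_
    · simpa [hw_def, KleinGordon.reflectedExtension, max_eq_right hx] using hvanish 0 le_rfl
    · rwa [lt_inv_comm₀ hθ₂ hθ₁, ← one_div, lt_div_iff₀ hθ₂]
    · refine KleinGordon.integral_exp_smul_eq_zero_of_volterra hwc hw (κ := 2 / θ₁)
        (by positivity) hθ₁ hs.1 ((lt_inv_comm₀ hθ₂ (hθ₁.trans hs.1)).2 hs.2)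
        (fun x t hx ht ↦ KleinGordon.norm_le_of_volterra hwc hw hθ₁ hdata hx ht) (C := C) ?_
      refine Filter.frequently_atTop.2 fun a ↦ ?_
      obtain ⟨y, hyY, hy⟩ := not_bddBelow_iff.1 hYinf (-a)
      exact ⟨-y, by linarith, hwY (-y) (by rwa [neg_neg])⟩
  intro x y hx hy
  -- With zero data, `C = 0` is admissible and the growth bound becomes uniqueness.
  have h := KleinGordon.norm_le_of_volterra hwc hw (C := 0) hθ₁
    (fun x _ ↦ by simpa using congr_fun hwzero x) hx (neg_nonneg.2 hy)
  rw [hw_def, KleinGordon.reflectedExtension_apply hx (neg_nonneg.2 hy), neg_neg] at h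
  simpa using h
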